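/- Let $(Q,\mathfrak n)$ be a regular local ring, let $Q\to R$ be a surjective ring homomorphism whose kernel is contained in $\mathfrak n^2$, so that $R$ is a local ring, and let $k$ be the common residue field of $Q$ and $R$. For a finitely generated module $M$ over a local ring $S$ ($S=Q$ or $S=R$) put $$P^S_M(t)=\sum_{n\ge 0}\dim_k\operatorname{Tor}^S_n(M,k)\,t^n .$$ A finitely generated $R$-module $M$ is called Golod if $$P^R_M(t)=\frac{P^Q_M(t)}{1-t\,\bigl(P^Q_R(t)-1\bigr)},$$ and $R$ is called a Golod ring if $k$ is a Golod $R$-module. The first syzygy $\operatorname{syz}^R M$ of a finitely generated $R$-module $M$ is the kernel of a minimal free cover $R^n\to M$ (a surjection whose kernel lies in $\mathfrak m R^n$, where $\mathfrak m$ is the maximal ideal of $R$), and $\operatorname{syz}^R_0 M=M$, $\operatorname{syz}^R_{n+1}M=\operatorname{syz}^R(\operatorname{syz}^R_n M)$. Theorem (Lescot). Let $R$ be a Golod ring, let $M$ be a finitely generated $R$-module and let $c=\operatorname{pd}_Q M$ be its projective dimension over $Q$ (put $c=0$ if $M=0$). Then the syzygy $\operatorname{syz}^R_{c+1}M$ is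 a Golod $R$-module. -/

import Mathlib

open CategoryTheory IsLocalRing
open scoped TensorProduct PowerSeries

universe u

noncomputable section

namespace Golod

/-- The Betti number `dim_k Tor_n^S(M, k)` of a module `M` over a local ring `S` with residue
field `k`. The module `Tor_n^S(M, k)` is killed by the maximal ideal, so that its length over `S`
is its dimension over `k`; it is finite when `S` is Noetherian and `M` is finitely generated. -/
def betti (S : Type u) [CommRing S] [IsLocalRing S]
    (M : Type u) [AddCommGroup M] [Module S M] (n : ℕ) : ℕ :=
  (Module.length S
    (((Tor' (ModuleCat.{u} S) n).obj (ModuleCat.of S M)).obj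
      (ModuleCat.of S (ResidueField S)))).toNat

/-- The Poincaré series `∑ₙ dim_k Tor_n^S(M, k) tⁿ`. -/
def poincareSeries (S : Type u) [CommRing S] [IsLocalRing S]
    (M : Type u) [AddCommGroup M] [Module S M] : ℤ⟦X⟧ :=
  PowerSeries.mk fun n => (betti S M n : ℤ)

/-- The denominator `1 - t (P^Q_R(t) - 1)` of the Golod bound. -/
def golodDenominator (Q R : Type u) [CommRing Q] [IsLocalRing Q] [CommRing R] [Algebra Q R] :
    ℤ⟦X⟧ :=
  1 - PowerSeries.X * (poincareSeries Q R - 1)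

/-- The Golod bound `P^Q_M(t) / (1 - t (P^Q_R(t) - 1))`. -/
def golodBound (Q R : Type u) [CommRing Q] [IsLocalRing Q] [CommRing R] [Algebra Q R]
    (M : Type u) [AddCommGroup M] [Module Q M] : ℤ⟦X⟧ :=
  poincareSeries Q M * PowerSeries.invOfUnit (golodDenominator Q R) 1

/-- The inverse in `golodBound` is an honest inverse. -/
theorem golodDenominator_mul_invOfUnit
    (Q R : Type u) [CommRing Q] [IsLocalRing Q] [CommRing R] [Algebra Q R] :
    golodDenominator Q R * PowerSeries.invOfUnit (golodDenominator Q R) 1 = 1 :=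
  PowerSeries.mul_invOfUnit _ _ (by simp [golodDenominator])

/-- A finitely generated `R`-module `M` is Golod with respect to `Q → R` if its Poincaré series
over `R` is equal to the Golod bound. -/
def IsGolodModule (Q R : Type u) [CommRing Q] [IsLocalRing Q] [CommRing R] [IsLocalRing R]
    [Algebra Q R] (M : Type u) [AddCommGroup M] [Module R M] [Module Q M]
    [IsScalarTower Q R M] : Prop :=
  Module.Finite R M ∧ poincareSeries R M = golodBound Q R M

/-- `R`, presented as a quotient of `Q`, is a Golod ring if its residue field is a Golod module. -/
def IsGolodRing (Q R : Type u) [CommRing Q] [IsLocalRing Q] [CommRing R] [IsLocalRing R]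
    [Algebra Q R] : Prop :=
  IsGolodModule Q R (ResidueField R)

/-- `N` is a first syzygy of `M` over the local ring `R`: it is isomorphic to the kernel of a
minimal free cover `Rⁿ → M`, that is, of a surjection whose kernel lies in `𝔪 Rⁿ`. -/
def IsFirstSyzygy (R : Type u) [CommRing R] [IsLocalRing R]
    (M : Type u) [AddCommGroup M] [Module R M] (N : Type u) [AddCommGroup N] [Module R N] :
    Prop :=
  ∃ (n : ℕ) (f : (Fin n → R) →ₗ[R] M), Function.Surjective f ∧
    LinearMap.ker f ≤ maximalIdeal R • (⊤ : Submodule R (Fin n → R)) ∧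
    Nonempty (N ≃ₗ[R] LinearMap.ker f)

/-- `N` is an `n`-th syzygy of `M` over the local ring `R` (it is unique up to isomorphism). -/
inductive IsSyzygy (R : Type u) [CommRing R] [IsLocalRing R]
    (M : Type u) [AddCommGroup M] [Module R M] :
    ℕ → (N : Type u) → [AddCommGroup N] → [Module R N] → Prop
  | zero (N : Type u) [AddCommGroup N] [Module R N] (e : M ≃ₗ[R] N) : IsSyzygy R M 0 N
  | succ (n : ℕ) (L : Type u) [AddCommGroup L] [Module R L]
      (N : Type u) [AddCommGroup N] [Module R N]
      (hL : IsSyzygy R M n L) (hN : IsFirstSyzygy R L N) : IsSyzygy R M (n + 1) N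

/-- Finitely generated modules have minimal free covers. -/
theorem exists_minimal_cover (R : Type u) [CommRing R] [IsLocalRing R]
    (M : Type u) [AddCommGroup M] [Module R M] [Module.Finite R M] :
    ∃ (n : ℕ) (f : (Fin n → R) →ₗ[R] M), Function.Surjective f ∧
      LinearMap.ker f ≤ maximalIdeal R • (⊤ : Submodule R (Fin n → R)) := by
  let k := ResidueField R
  let b := Module.finBasis k (k ⊗[R] M)
  have hs : Function.Surjective (TensorProduct.mk R k M 1) :=
    TensorProduct.mk_surjective R M k (IsLocalRing.residue_surjective)
  choose v hv using fun i => hs (b i)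
  have hv' : ∀ i, (1 : k) ⊗ₜ[R] v i = b i := hv
  refine ⟨_, Fintype.linearCombination R v, ?_, ?_⟩
  · rw [← LinearMap.range_eq_top, Fintype.range_linearCombination]
    exact IsLocalRing.span_eq_top_of_tmul_eq_basis (R := R) v b hv'
  · intro x hx
    have hx' : ∑ i, x i • v i = 0 := by
      simpa [Fintype.linearCombination_apply] using hx
    have h0 : ∑ i, (residue R (x i)) • b i = 0 := by
      have := congrArg (TensorProduct.mk R k M 1) hx'
      rw [map_sum, map_zero] at this
      rw [← this]
      refine Finset.sum_congr rfl fun i _ => ?_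
      rw [map_smul, hv i]
      exact (algebraMap_smul k (x i) (b i))
    have h1 := Fintype.linearIndependent_iff.1 b.linearIndependent _ h0
    rw [pi_eq_sum_univ' x]
    refine Submodule.sum_mem _ fun i _ => Submodule.smul_mem_smul ?_ trivial
    exact (IsLocalRing.residue_eq_zero_iff _).1 (h1 i)

/-- Over a Noetherian local ring all syzygies of a finitely generated module exist. -/
theorem exists_isSyzygy (R : Type u) [CommRing R] [IsLocalRing R] [IsNoetherianRing R]
    (M : Type u) [AddCommGroup M] [Module R M] [Module.Finite R M] (n : ℕ) :
    ∃ (N : ModuleCat.{u} R), Module.Finite R N ∧ IsSyzygy R M n N := by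
  induction n with
  | zero => exact ⟨ModuleCat.of R M, ‹_›, .zero _ (LinearEquiv.refl R M)⟩
  | succ n ih =>
    obtain ⟨L, hL, hs⟩ := ih
    obtain ⟨m, f, hf, hk⟩ := exists_minimal_cover R L
    exact ⟨ModuleCat.of R (LinearMap.ker f), Module.Finite.of_fg (IsNoetherian.noetherian _),
      .succ n L _ hs ⟨m, f, hf, hk, ⟨LinearEquiv.refl R _⟩⟩⟩

end Golod

end

/-! Choose free resolutions `G` and `F` of `k` over `Q` and `R` such that the comparison `R ⊗_Q G →
F` is surjective in every degree, and let `K` be its kernel (`comparisonSequence`). Since `F` is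
projective in each degree, `0 → N ⊗ K → N ⊗_Q G → N ⊗ F → 0` is exact for every `R`-module `N`. Its
long exact sequence links `H_i(N ⊗ K)` with `Tor^Q_i(N, k)` and `Tor^R_i(N, k)`. For `N = R` it
gives `H_0(K) = 0` and identifies the length of `H_i(K)` with the `i`-th Betti number of `R` over
`Q` for `i > 0`.

Dimension shifting along minimal covers bounds the length of `H_i(N ⊗ K)` by the sum over `p + q =
i` of `length H_p(K)` times the `q`-th Betti number of `N` over `R` (`length_tensorHomology_le`).
This is the convolution that occurs in the Golod bound. If `R` is Golod, the bound is attained for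
`N = k`, which forces `H_i(K) → H_i(k ⊗ K)` to be injective (`IsGolodRing.injective`). Then maps to
`R^m` with image in `𝔪 R^m` induce zero on `H_i(- ⊗ K)`, and the bound is attained for every
finitely generated `N`. Such an `N` is therefore Golod once all maps `H_i(N ⊗ K) → Tor^Q_i(N, k)`
vanish (`IsGolodRing.isGolodModule_of_eq_zero`).

If `N` is a first syzygy of `L`, the connecting map `H_{i+1}(L ⊗ K) → H_i(N ⊗ K)` is now onto, so
vanishing for `L` in degree `i + 1` gives vanishing for `N` in degree `i`. For `M` the maps vanish
in all degrees above `c`, because `Tor^Q` does; after `c + 1` syzygies they vanish in all degrees.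
-/

/-! ### Splicing short exact sequences into resolutions. -/

/-- A sequence of short exact sequences `0 → M (n + 1) → P n → M n → 0`, to be spliced into a
resolution of `M 0`. -/
structure SyzygySequence (S : Type u) [CommRing S] where
  M : ℕ → ModuleCat.{u} S
  P : ℕ → ModuleCat.{u} S
  ι : ∀ n, M (n + 1) ⟶ P n
  ε : ∀ n, P n ⟶ M n
  w : ∀ n, ι n ≫ ε n = 0
  shortExact : ∀ n, (ShortComplex.mk (ι n) (ε n) (w n)).ShortExact

namespace SyzygySequence

variable {S : Type u} [CommRing S] (s : SyzygySequence S)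

/-- The spliced complex. -/
noncomputable def complex : ChainComplex (ModuleCat.{u} S) ℕ :=
  ChainComplex.of s.P (fun n => s.ε (n + 1) ≫ s.ι n) fun n => by
    rw [Category.assoc, ← Category.assoc (s.ι (n + 1)), s.w, Limits.zero_comp, Limits.comp_zero]

@[simp]
theorem complex_d (n : ℕ) : s.complex.d (n + 1) n = s.ε (n + 1) ≫ s.ι n :=
  ChainComplex.of_d s.P (fun n => s.ε (n + 1) ≫ s.ι n) n

theorem ε_ι_ε (n : ℕ) : (s.ε (n + 1) ≫ s.ι n) ≫ s.ε n = 0 := by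
  rw [Category.assoc, s.w, Limits.comp_zero]

theorem exact_ε_ι (n : ℕ) :
    (ShortComplex.mk (s.ε (n + 1) ≫ s.ι n) (s.ε n)
      (by rw [Category.assoc, s.w, Limits.comp_zero])).Exact := by
  have := (s.shortExact (n + 1)).epi_g
  let φ : ShortComplex.mk (s.ε (n + 1) ≫ s.ι n) (s.ε n)
      (by rw [Category.assoc, s.w, Limits.comp_zero]) ⟶ ShortComplex.mk (s.ι n) (s.ε n) (s.w n) :=
    { τ₁ := s.ε (n + 1), τ₂ := 𝟙 _, τ₃ := 𝟙 _ }
  have : Epi φ.τ₁ := this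
  have : IsIso φ.τ₂ := by dsimp [φ]; infer_instance
  have : Mono φ.τ₃ := by dsimp [φ]; infer_instance
  exact (ShortComplex.exact_iff_of_epi_of_isIso_of_mono φ).2 (s.shortExact n).exact

/-- Following `ε (n + 1)` by the monomorphism `ι n` does not change its kernel, so this reduces to
`exact_ε_ι`. -/
theorem exactAt_succ (n : ℕ) : s.complex.ExactAt (n + 1) := by
  rw [HomologicalComplex.exactAt_iff' _ (n + 1 + 1) (n + 1) n (by simp) (by simp)]
  have h := s.exact_ε_ι (n + 1)
  have := (s.shortExact n).mono_f
  let φ : ShortComplex.mk (s.ε (n + 2) ≫ s.ι (n + 1)) (s.ε (n + 1))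
      (by rw [Category.assoc, s.w, Limits.comp_zero]) ⟶ s.complex.sc' (n + 1 + 1) (n + 1) n :=
    { τ₁ := 𝟙 _
      τ₂ := 𝟙 _
      τ₃ := s.ι n
      comm₁₂ := by
        simp only [HomologicalComplex.shortComplexFunctor'_obj_f, complex_d]
        exact (Category.id_comp _).trans (Category.comp_id _).symm
      comm₂₃ := by
        simp only [HomologicalComplex.shortComplexFunctor'_obj_g, complex_d]
        exact Category.id_comp _ }
  have : Epi φ.τ₁ := inferInstanceAs (Epi (𝟙 (s.P (n + 2))))
  have : IsIso φ.τ₂ := inferInstanceAs (IsIso (𝟙 (s.P (n + 1))))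
  have : Mono φ.τ₃ := ‹Mono (s.ι n)›
  exact (ShortComplex.exact_iff_of_epi_of_isIso_of_mono φ).1 h

/-- The augmentation of the spliced complex. -/
noncomputable def π : s.complex ⟶ (ChainComplex.single₀ (ModuleCat.{u} S)).obj (s.M 0) :=
  (ChainComplex.toSingle₀Equiv _ _).symm ⟨s.ε 0,
    (congrArg (fun f => CategoryStruct.comp f (s.ε 0)) (s.complex_d 0)).trans
      (s.ε_ι_ε 0)⟩

instance : QuasiIso s.π := ⟨fun n => by
  cases n
  · rw [ChainComplex.quasiIsoAt₀_iff, ShortComplex.quasiIso_iff_of_zeros']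
    · have := (s.shortExact 0).epi_g
      refine (ShortComplex.exact_and_epi_g_iff_of_iso ?_).2 ⟨s.exact_ε_ι 0, this⟩
      exact ShortComplex.isoMk (Iso.refl _) (Iso.refl _) (Iso.refl _)
        (by simp; rfl) (by simp; rfl)
    all_goals rfl
  · rw [quasiIsoAt_iff_exactAt']
    · apply exactAt_succ
    · apply ChainComplex.exactAt_succ_single_obj⟩

/-- The spliced complex is a projective resolution if its terms are projective. -/
noncomputable def resolution [∀ n, Projective (s.P n)] : ProjectiveResolution (s.M 0) where
  complex := s.complex
  projective n := inferInstanceAs (Projective (s.P n))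
  π := s.π

end SyzygySequence

/-! ### Minimal free resolutions and Betti numbers. -/

namespace Golod

variable {S : Type u} [CommRing S] [IsLocalRing S]

theorem length_pi_fin_tensor_residueField (b : ℕ) :
    Module.length S ((Fin b → S) ⊗[S] ResidueField S) = b := by
  rw [((TensorProduct.comm S _ _).trans
    (TensorProduct.piScalarRight S S (ResidueField S) (Fin b))).length_eq]
  rw [Module.length_pi, Module.length_eq_of_surjective (R := ResidueField S)
    IsLocalRing.residue_surjective, Module.length_eq_one]
  simp

theorem tmul_residueField_eq_zero {P : Type u} [AddCommGroup P] [Module S P] {x : P}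
    (hx : x ∈ maximalIdeal S • (⊤ : Submodule S P)) (y : ResidueField S) :
    x ⊗ₜ[S] y = 0 := by
  refine Submodule.smul_induction_on hx (fun a ha p _ => ?_) fun x y hx hy => ?_
  · rw [TensorProduct.smul_tmul, ← algebraMap_smul (ResidueField S) a y,
      ResidueField.algebraMap_eq, (IsLocalRing.residue_eq_zero_iff a).2 ha, zero_smul,
      TensorProduct.tmul_zero]
  · rw [TensorProduct.add_tmul, hx, hy, add_zero]

/-- The spliced resolution consists of the free modules of rank `b n` and is minimal. -/
structure _root_.SyzygySequence.IsMinimal (s : SyzygySequence S) (b : ℕ → ℕ) : Prop where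
  P_eq : ∀ n, s.P n = ModuleCat.of S (Fin (b n) → S)
  ι_mem : ∀ n x, (s.ι n).hom x ∈ maximalIdeal S • (⊤ : Submodule S (s.P n))

/-- In a minimal free resolution the Betti numbers are the ranks. -/
theorem length_tor_of_minimal {s : SyzygySequence S} {b : ℕ → ℕ}
    (hs : s.IsMinimal b) (n : ℕ) :
    Module.length S (((Tor' (ModuleCat.{u} S) n).obj (s.M 0)).obj
      (ModuleCat.of S (ResidueField S))) = b n := by
  have (n : ℕ) : Projective (s.P n) := by
    rw [hs.P_eq]; exact ModuleCat.projective_of_free (Pi.basisFun S (Fin (b n)))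
  let T := (MonoidalCategory.tensoringRight (ModuleCat.{u} S)).obj
    (ModuleCat.of S (ResidueField S))
  let C := (T.mapHomologicalComplex (ComplexShape.down ℕ)).obj s.complex
  -- By minimality the differentials land in `𝔪 P`, hence die after tensoring with `k`; the complex
  -- is then its own homology.
  have hd (i j : ℕ) : C.d i j = 0 := by
    by_cases hij : j + 1 = i
    · subst hij
      have : C.d (j + 1) j = T.map (s.ε (j + 1) ≫ s.ι j) :=
        congrArg T.map (s.complex_d j)
      rw [this]
      refine ModuleCat.hom_ext (TensorProduct.ext' fun x y => ?_)
      exact tmul_residueField_eq_zero (hs.ι_mem j _) y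
    · exact C.shape i j hij
  have e1 := (s.resolution.isoLeftDerivedObj T n).toLinearEquiv.length_eq
  have e2 : Module.length S (C.homology n) = Module.length S (C.X n) :=
    (ShortComplex.HomologyData.ofZeros (C.sc n) (hd _ _)
      (hd _ _)).left.homologyIso.toLinearEquiv.length_eq
  refine e1.trans (e2.trans ?_)
  change Module.length S ((s.P n) ⊗[S] ResidueField S) = _
  rw [hs.P_eq, length_pi_fin_tensor_residueField]

/-- Prolongation of a sequence of syzygies to the left. -/
def _root_.SyzygySequence.cons (s : SyzygySequence S) {M P : ModuleCat.{u} S} (ι : s.M 0 ⟶ P)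
    (ε : P ⟶ M) (w : ι ≫ ε = 0) (h : (ShortComplex.mk ι ε w).ShortExact) : SyzygySequence S where
  M n := n.casesOn M s.M
  P n := n.casesOn P s.P
  ι n := match n with
    | 0 => ι
    | n + 1 => s.ι n
  ε n := match n with
    | 0 => ε
    | n + 1 => s.ε n
  w n := match n with
    | 0 => w
    | n + 1 => s.w n
  shortExact n := match n with
    | 0 => h
    | n + 1 => s.shortExact n

theorem _root_.SyzygySequence.IsMinimal.cons {s : SyzygySequence S} {b : ℕ → ℕ}
    (hs : s.IsMinimal b) {M : ModuleCat.{u} S} {m : ℕ}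
    (ι : s.M 0 ⟶ ModuleCat.of S (Fin m → S)) (ε : ModuleCat.of S (Fin m → S) ⟶ M)
    (w : ι ≫ ε = 0) (h : (ShortComplex.mk ι ε w).ShortExact)
    (hι : ∀ x, ι.hom x ∈ maximalIdeal S • (⊤ : Submodule S (Fin m → S))) :
    (s.cons ι ε w h).IsMinimal (fun n => n.casesOn m b) where
  P_eq n := match n with
    | 0 => rfl
    | n + 1 => hs.P_eq n
  ι_mem n := match n with
    | 0 => hι
    | n + 1 => hs.ι_mem n

/-- A first syzygy and its minimal free cover as a short exact sequence. -/
theorem IsFirstSyzygy.exists_shortExact {M N : Type u} [AddCommGroup M] [Module S M]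
    [AddCommGroup N] [Module S N] (h : IsFirstSyzygy S M N) :
    ∃ (m : ℕ) (ι : ModuleCat.of S N ⟶ ModuleCat.of S (Fin m → S))
      (ε : ModuleCat.of S (Fin m → S) ⟶ ModuleCat.of S M) (w : ι ≫ ε = 0),
      (ShortComplex.mk ι ε w).ShortExact ∧
        ∀ x, ι.hom x ∈ maximalIdeal S • (⊤ : Submodule S (Fin m → S)) := by
  obtain ⟨m, f, hf, hk, ⟨e⟩⟩ := h
  refine ⟨m, ModuleCat.ofHom ((LinearMap.ker f).subtype ∘ₗ e.toLinearMap), ModuleCat.ofHom f,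
    ?_, ?_, fun x => hk (e x).2⟩
  · ext x
    exact (e x).2
  · refine ShortComplex.ShortExact.mk' ?_ ?_ ?_
    · rw [ShortComplex.ShortExact.moduleCat_exact_iff_function_exact]
      intro y
      refine ⟨fun hy => ⟨e.symm ⟨y, hy⟩, ?_⟩, ?_⟩
      · change ((e (e.symm ⟨y, hy⟩) : LinearMap.ker f) : Fin m → S) = y
        rw [e.apply_symm_apply]
      · rintro ⟨x, rfl⟩
        exact (e x).2
    · rw [ModuleCat.mono_iff_injective]
      exact Subtype.val_injective.comp e.injective
    · rw [ModuleCat.epi_iff_surjective]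
      exact hf

theorem exists_isFirstSyzygy [IsNoetherianRing S] (M : ModuleCat.{u} S) [Module.Finite S M] :
    ∃ N : ModuleCat.{u} S, Module.Finite S N ∧ IsFirstSyzygy S M N := by
  obtain ⟨m, f, hf, hk⟩ := exists_minimal_cover S M
  exact ⟨ModuleCat.of S (LinearMap.ker f), Module.Finite.of_fg (IsNoetherian.noetherian _),
    m, f, hf, hk, ⟨LinearEquiv.refl S _⟩⟩

theorem exists_isMinimal [IsNoetherianRing S] (M : Type u) [AddCommGroup M] [Module S M]
    [Module.Finite S M] :
    ∃ (s : SyzygySequence S) (b : ℕ → ℕ), s.M 0 = ModuleCat.of S M ∧ s.IsMinimal b := by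
  choose next hfin hnext using fun M : {M : ModuleCat.{u} S // Module.Finite S M} =>
    haveI := M.2
    exists_isFirstSyzygy M.1
  let seq (n : ℕ) : {M : ModuleCat.{u} S // Module.Finite S M} :=
    n.rec ⟨ModuleCat.of S M, ‹_›⟩ fun _ L => ⟨next L, hfin L⟩
  choose b ι ε w hse hmem using fun n => (hnext (seq n)).exists_shortExact
  exact ⟨⟨fun n => (seq n).1, fun n => ModuleCat.of S (Fin (b n) → S), ι, ε, w, hse⟩, b, rfl,
    ⟨fun _ => rfl, hmem⟩⟩

theorem betti_congr {M N : Type u} [AddCommGroup M] [Module S M] [AddCommGroup N] [Module S N]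
    (e : M ≃ₗ[S] N) (n : ℕ) : betti S M n = betti S N n :=
  congrArg ENat.toNat (((Tor' (ModuleCat.{u} S) n).mapIso e.toModuleIso).app
    (ModuleCat.of S (ResidueField S))).toLinearEquiv.length_eq

theorem betti_succ_of_projective (M : ModuleCat.{u} S) [Projective M] (n : ℕ) :
    betti S M (n + 1) = 0 := by
  have h := isZero_Tor'_succ_of_projective _ M (ModuleCat.of S (ResidueField S)) n
  have := ModuleCat.subsingleton_of_isZero h
  rw [betti, Module.length_eq_zero, ENat.toNat_zero]

variable [IsNoetherianRing S]

/-- Prolonging a minimal resolution of `N` by the given minimal cover yields a minimal resolution of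
`M` whose ranks are `m` followed by those for `N`. -/
theorem betti_of_shortExact {M N : Type u} [AddCommGroup M] [Module S M] [AddCommGroup N]
    [Module S N] [Module.Finite S N] {m : ℕ}
    (ι : ModuleCat.of S N ⟶ ModuleCat.of S (Fin m → S))
    (ε : ModuleCat.of S (Fin m → S) ⟶ ModuleCat.of S M)
    (w : ι ≫ ε = 0) (h : (ShortComplex.mk ι ε w).ShortExact)
    (hι : ∀ x, ι.hom x ∈ maximalIdeal S • (⊤ : Submodule S (Fin m → S))) :
    betti S M 0 = m ∧ ∀ n, betti S M (n + 1) = betti S N n := by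
  obtain ⟨s, b, h0, hs⟩ := exists_isMinimal (S := S) N
  have w' : (eqToHom h0 ≫ ι) ≫ ε = 0 := by rw [Category.assoc, w, Limits.comp_zero]
  have h' : (ShortComplex.mk (eqToHom h0 ≫ ι) ε w').ShortExact :=
    ShortComplex.shortExact_of_iso (S₁ := ShortComplex.mk ι ε w)
      (ShortComplex.isoMk (eqToIso h0).symm (Iso.refl _) (Iso.refl _) (by simp) (by simp)) h
  have hcons := hs.cons (eqToHom h0 ≫ ι) ε w' h' fun x => hι ((eqToHom h0).hom x)
  have hM (n : ℕ) := length_tor_of_minimal hcons n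
  refine ⟨?_, fun n => ?_⟩
  · exact (congrArg ENat.toNat (hM 0)).trans (ENat.toNat_natCast _)
  · have hN := length_tor_of_minimal hs n
    rw [h0] at hN
    exact (congrArg ENat.toNat ((hM (n + 1)).trans hN.symm))

/-- Passing to a first syzygy lowers both the bound on the projective dimension and the index of the
Betti number by one; the base case is a projective module. -/
theorem betti_eq_zero_of_hasProjectiveDimensionLT (c : ℕ) (M : ModuleCat.{u} S)
    [Module.Finite S M] [HasProjectiveDimensionLT M (c + 1)] (n : ℕ) (hn : c < n) :
    betti S M n = 0 := by
  induction c generalizing M n with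
  | zero =>
    obtain ⟨n, rfl⟩ := Nat.exists_eq_succ_of_ne_zero hn.ne'
    have : Projective M := projective_iff_hasProjectiveDimensionLT_one.2 ‹_›
    exact betti_succ_of_projective M n
  | succ c ih =>
    obtain ⟨n, rfl⟩ := Nat.exists_eq_succ_of_ne_zero (Nat.ne_zero_of_lt hn)
    obtain ⟨N, hfin, hN⟩ := exists_isFirstSyzygy M
    obtain ⟨m, ι, ε, w, hse, hι⟩ := hN.exists_shortExact
    have : Projective (ModuleCat.of S (Fin m → S)) :=
      ModuleCat.projective_of_free (Pi.basisFun S (Fin m))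
    have : HasProjectiveDimensionLT N (c + 1) :=
      (hse.hasProjectiveDimensionLT_X₃_iff c this).1 ‹_›
    exact ((betti_of_shortExact ι ε w hse hι).2 n).trans (ih N n (Nat.lt_of_succ_lt_succ hn))

end Golod

/-! ### The functors `N ↦ H_i(N ⊗ X)` and their long exact sequences. -/

section TensorComplex

open MonoidalCategory

variable {R : Type u} [CommRing R]

/-- The functor `N ↦ N ⊗ X` for a complex `X`. -/
noncomputable def tensorComplex (X : ChainComplex (ModuleCat.{u} R) ℕ) :
    ModuleCat.{u} R ⥤ ChainComplex (ModuleCat.{u} R) ℕ where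
  obj N := ((tensorLeft N).mapHomologicalComplex _).obj X
  map f :=
    { f := fun i => f ▷ X.X i
      comm' := fun _ _ _ => (whisker_exchange f _).symm }
  map_id N := by ext i : 1; exact id_whiskerRight N (X.X i)
  map_comp f g := by ext i : 1; exact comp_whiskerRight f g (X.X i)

instance (X : ChainComplex (ModuleCat.{u} R) ℕ) : (tensorComplex X).Additive where
  map_add {M N f g} := by ext i : 1; exact MonoidalPreadditive.add_whiskerRight f g

/-- The functor `N ↦ Hᵢ(N ⊗ X)`. -/
noncomputable abbrev tensorHomology (X : ChainComplex (ModuleCat.{u} R) ℕ) (i : ℕ) :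
    ModuleCat.{u} R ⥤ ModuleCat.{u} R :=
  tensorComplex X ⋙ HomologicalComplex.homologyFunctor _ _ i

/-- A chain map `X ⟶ Y` induces chain maps `N ⊗ X ⟶ N ⊗ Y`, naturally in `N`. -/
noncomputable def tensorComplexMap {X Y : ChainComplex (ModuleCat.{u} R) ℕ} (φ : X ⟶ Y) :
    tensorComplex X ⟶ tensorComplex Y where
  app N := ((tensorLeft N).mapHomologicalComplex _).map φ
  naturality _ _ f := by ext i : 1; exact (whisker_exchange f (φ.f i)).symm

/-- A chain map `X ⟶ Y` induces maps `Hᵢ(N ⊗ X) ⟶ Hᵢ(N ⊗ Y)`, naturally in `N`. -/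
noncomputable def tensorHomologyMap {X Y : ChainComplex (ModuleCat.{u} R) ℕ} (φ : X ⟶ Y) (i : ℕ) :
    tensorHomology X i ⟶ tensorHomology Y i :=
  Functor.whiskerRight (tensorComplexMap φ) _

theorem CategoryTheory.ShortComplex.ShortExact.map_tensorComplex
    {T : ShortComplex (ModuleCat.{u} R)} (hT : T.ShortExact) (X : ChainComplex (ModuleCat.{u} R) ℕ)
    [∀ i, Module.Flat R (X.X i)] : (T.map (tensorComplex X)).ShortExact := by
  refine HomologicalComplex.shortExact_of_degreewise_shortExact _ fun i => ?_
  exact hT.map_of_exact (tensorRight (X.X i))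

/-- No flatness of `N` is needed: projectivity of the third term splits the sequence in each degree,
and splittings survive any additive functor. -/
theorem CategoryTheory.ShortComplex.ShortExact.map_tensorLeft
    {T : ShortComplex (ChainComplex (ModuleCat.{u} R) ℕ)}
    (hT : T.ShortExact) [∀ i, Projective (T.X₃.X i)] (N : ModuleCat.{u} R) :
    (T.map ((tensorLeft N).mapHomologicalComplex (ComplexShape.down ℕ))).ShortExact := by
  refine HomologicalComplex.shortExact_of_degreewise_shortExact _ fun i => ?_
  have h := hT.map_of_exact (HomologicalComplex.eval _ _ i)
  have : Projective (T.map (HomologicalComplex.eval _ _ i)).X₃ :=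
    inferInstanceAs (Projective (T.X₃.X i))
  exact (h.splittingOfProjective.map (tensorLeft N)).shortExact

/-- No differential leaves degree `0`, so `H_0` is a cokernel there, and cokernels inherit
epimorphisms. -/
theorem homologyMap_zero_surjective {X Y : ChainComplex (ModuleCat.{u} R) ℕ} (φ : X ⟶ Y) [Epi φ] :
    Function.Surjective (HomologicalComplex.homologyMap φ 0).hom := by
  have h : Epi (HomologicalComplex.homologyMap φ 0 ≫ HomologicalComplex.homologyι Y 0) := by
    rw [HomologicalComplex.homologyι_naturality φ 0]; infer_instance
  exact (ModuleCat.epi_iff_surjective _).1 ((epi_comp_iff_of_isIso _ _).1 h)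

variable (X : ChainComplex (ModuleCat.{u} R) ℕ) [∀ i, Module.Flat R (X.X i)]

section Sequence

variable {T : ShortComplex (ModuleCat.{u} R)} (hT : T.ShortExact) (i : ℕ)

include hT

theorem tensorHomology_exact₂ :
    Function.Exact ((tensorHomology X i).map T.f).hom ((tensorHomology X i).map T.g).hom :=
  (ShortComplex.ShortExact.moduleCat_exact_iff_function_exact _).1
    ((hT.map_tensorComplex X).homology_exact₂ i)

theorem tensorHomology_exact₃ :
    Function.Exact ((tensorHomology X (i + 1)).map T.g).hom
      ((hT.map_tensorComplex X).δ (i + 1) i rfl).hom :=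
  (ShortComplex.ShortExact.moduleCat_exact_iff_function_exact _).1
    ((hT.map_tensorComplex X).homology_exact₃ (i + 1) i rfl)

theorem tensorHomology_exact₁ :
    Function.Exact ((hT.map_tensorComplex X).δ (i + 1) i rfl).hom
      ((tensorHomology X i).map T.f).hom :=
  (ShortComplex.ShortExact.moduleCat_exact_iff_function_exact _).1
    ((hT.map_tensorComplex X).homology_exact₁ (i + 1) i rfl)

theorem tensorHomology_zero_surjective :
    Function.Surjective ((tensorHomology X 0).map T.g).hom := by
  have : Epi ((tensorComplex X).map T.g) := (hT.map_tensorComplex X).epi_g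
  exact homologyMap_zero_surjective ((tensorComplex X).map T.g)

omit [∀ i, Module.Flat R (X.X i)] hT in
theorem tensorHomologyMap_δ {Y : ChainComplex (ModuleCat.{u} R) ℕ}
    [∀ i, Module.Flat R (X.X i)] [∀ i, Module.Flat R (Y.X i)] (φ : X ⟶ Y) (hT : T.ShortExact) :
    (hT.map_tensorComplex X).δ (i + 1) i rfl ≫ (tensorHomologyMap φ i).app T.X₁ =
      (tensorHomologyMap φ (i + 1)).app T.X₃ ≫ (hT.map_tensorComplex Y).δ (i + 1) i rfl :=
  HomologicalComplex.HomologySequence.δ_naturality (T.mapNatTrans (tensorComplexMap φ)) _ _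
    (i + 1) i rfl

end Sequence

end TensorComplex

/-! ### Additive functors on finite free modules. -/

namespace CategoryTheory.Functor

variable {R : Type u} [CommRing R] (Φ : ModuleCat.{u} R ⥤ ModuleCat.{u} R) [Φ.Additive]

theorem sum_map_single_map_proj {n : ℕ} (x : Φ.obj (ModuleCat.of R (Fin n → R))) :
    ∑ i, (Φ.map (ModuleCat.ofHom (LinearMap.single R (fun _ : Fin n => R) i))).hom
      ((Φ.map (ModuleCat.ofHom (LinearMap.proj i))).hom x) = x := by
  have h : ∑ i, ModuleCat.ofHom (LinearMap.proj i) ≫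
      ModuleCat.ofHom (LinearMap.single R (fun _ : Fin n => R) i) =
      𝟙 (ModuleCat.of R (Fin n → R)) := by
    refine ModuleCat.hom_ext (LinearMap.ext fun y => ?_)
    rw [ModuleCat.hom_sum, LinearMap.sum_apply]
    exact Finset.univ_sum_single y
  have h' := congrArg (fun f => (Φ.map f).hom x) h
  simpa only [Functor.map_sum, Functor.map_id, Functor.map_comp, ModuleCat.hom_sum,
    LinearMap.sum_apply, ModuleCat.hom_comp, LinearMap.comp_apply, ModuleCat.hom_id,
    LinearMap.id_apply] using h'

theorem map_proj_map_single {n : ℕ} (i j : Fin n) (x : Φ.obj (ModuleCat.of R R)) :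
    (Φ.map (ModuleCat.ofHom (LinearMap.proj j))).hom
      ((Φ.map (ModuleCat.ofHom (LinearMap.single R (fun _ : Fin n => R) i))).hom x) =
      if i = j then x else 0 := by
  rw [← LinearMap.comp_apply, ← ModuleCat.hom_comp, ← Functor.map_comp, ← ModuleCat.ofHom_comp]
  split_ifs with h
  · subst h
    have : ModuleCat.ofHom ((LinearMap.proj i).comp (LinearMap.single R (fun _ : Fin n => R) i)) =
        𝟙 (ModuleCat.of R R) := by
      rw [LinearMap.proj_comp_single_same]; rfl
    rw [this, Φ.map_id]; rfl
  · have : ModuleCat.ofHom ((LinearMap.proj j).comp (LinearMap.single R (fun _ : Fin n => R) i)) =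
        0 := by
      rw [LinearMap.proj_comp_single_ne _ _ _ _ (Ne.symm h)]; rfl
    rw [this, Φ.map_zero]; rfl

/-- Additive functors preserve finite powers. -/
noncomputable def objPiEquiv (n : ℕ) :
    Φ.obj (ModuleCat.of R (Fin n → R)) ≃ₗ[R] (Fin n → Φ.obj (ModuleCat.of R R)) :=
  { LinearMap.pi fun i =>
      (Φ.map (ModuleCat.ofHom (LinearMap.proj i : (Fin n → R) →ₗ[R] R))).hom with
    invFun := fun y =>
      ∑ i, (Φ.map (ModuleCat.ofHom (LinearMap.single R (fun _ : Fin n => R) i))).hom (y i)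
    left_inv := fun x => Φ.sum_map_single_map_proj x
    right_inv := fun y => by
      funext j
      refine (_root_.map_sum
        (Φ.map (ModuleCat.ofHom (LinearMap.proj j : (Fin n → R) →ₗ[R] R))).hom _ _).trans ?_
      simp_rw [map_proj_map_single]
      simp }

theorem length_obj_pi (n : ℕ) :
    Module.length R (Φ.obj (ModuleCat.of R (Fin n → R))) =
      n * Module.length R (Φ.obj (ModuleCat.of R R)) := by
  rw [(Φ.objPiEquiv n).length_eq, Module.length_pi]
  simp

/-- The residue map `R ⟶ k` as a morphism. -/
noncomputable def _root_.ModuleCat.residue (R : Type u) [CommRing R] [IsLocalRing R] :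
    ModuleCat.of R R ⟶ ModuleCat.of R (ResidueField R) :=
  ModuleCat.ofHom (Algebra.linearMap R (ResidueField R))

/-- If `Φ` is injective on the residue map, then it annihilates minimal maps to free modules. -/
theorem map_eq_zero_of_mem_maximalIdeal [IsLocalRing R]
    (hΦ : Function.Injective (Φ.map (ModuleCat.residue R)).hom) {N : ModuleCat.{u} R} {n : ℕ}
    (f : N ⟶ ModuleCat.of R (Fin n → R))
    (hf : ∀ x, f.hom x ∈ maximalIdeal R • (⊤ : Submodule R (Fin n → R))) : Φ.map f = 0 := by
  -- Each coordinate of `f` lies in `𝔪` and so vanishes in `k`. Injectivity of `Φ` on the residue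
  -- map then kills `Φ` of the coordinate itself, and the coordinates determine `Φ.map f`.
  have h0 (j : Fin n) : f ≫ ModuleCat.ofHom (LinearMap.proj j) ≫ ModuleCat.residue R = 0 := by
    refine ModuleCat.hom_ext (LinearMap.ext fun x => ?_)
    change residue R (f.hom x j) = 0
    rw [IsLocalRing.residue_eq_zero_iff]
    refine Submodule.smul_induction_on (hf x) (fun a ha p _ => ?_) fun x y hx hy => ?_
    · exact Ideal.mul_mem_right _ _ ha
    · exact Ideal.add_mem _ hx hy
  refine ModuleCat.hom_ext (LinearMap.ext fun x => ?_)
  rw [← Φ.sum_map_single_map_proj ((Φ.map f).hom x)]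
  refine Finset.sum_eq_zero fun j _ => ?_
  have : (Φ.map (ModuleCat.ofHom (LinearMap.proj j))).hom ((Φ.map f).hom x) = 0 := by
    apply hΦ
    have h := congrArg (fun g => (Φ.map g).hom x) (h0 j)
    simp only [Functor.map_comp, Functor.map_zero] at h
    rw [map_zero]
    exact h
  rw [this, map_zero]

end CategoryTheory.Functor

/-! ### The convolution bound for `H_i(M ⊗ X)` and the case of equality. -/

namespace Golod

section

variable {R A B C : Type*} [Ring R] [AddCommGroup A] [Module R A] [AddCommGroup B] [Module R B]
  [AddCommGroup C] [Module R C] {f : A →ₗ[R] B} {g : B →ₗ[R] C}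

theorem length_eq_range_add_range (h : Function.Exact f g) :
    Module.length R B =
      Module.length R (LinearMap.range f) + Module.length R (LinearMap.range g) := by
  refine Module.length_eq_add_of_exact (LinearMap.range f).subtype g.rangeRestrict
    Subtype.val_injective g.surjective_rangeRestrict fun x => ?_
  rw [Submodule.coe_subtype, Subtype.range_coe]
  exact (by simp [LinearMap.rangeRestrict, Subtype.ext_iff] : _ ↔ g x = 0).trans (h x)

theorem length_le_add_of_exact (h : Function.Exact f g) :
    Module.length R B ≤ Module.length R A + Module.length R C := by
  rw [length_eq_range_add_range h]
  exact add_le_add (Module.length_le_of_surjective f.rangeRestrict f.surjective_rangeRestrict)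
    (Module.length_le_of_injective (LinearMap.range g).subtype Subtype.val_injective)

end

variable {R : Type u} [CommRing R] [IsLocalRing R] [IsNoetherianRing R]
  (X : ChainComplex (ModuleCat.{u} R) ℕ) [∀ i, Module.Flat R (X.X i)]
  {h : ℕ → ℕ} (hX : ∀ j, Module.length R ((tensorHomology X j).obj (ModuleCat.of R R)) = h j)

include hX

/-- Dimension shifting: for a minimal cover `R^m → M` with kernel `N`, the module `H_{i+1}(M ⊗ X)`
sits between `H_{i+1}(X)^m`, which gives the term `(i + 1, 0)`, and `H_i(N ⊗ X)`, which gives the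
others by induction. -/
theorem length_tensorHomology_le (i : ℕ) (M : ModuleCat.{u} R) [Module.Finite R M] :
    Module.length R ((tensorHomology X i).obj M) ≤
      (∑ p ∈ Finset.HasAntidiagonal.antidiagonal i, h p.1 * betti R M p.2 : ℕ) := by
  induction i generalizing M with
  | zero =>
    obtain ⟨N, hfin, hN⟩ := exists_isFirstSyzygy M
    obtain ⟨m, ι, ε, w, hse, hι⟩ := hN.exists_shortExact
    refine (Module.length_le_of_surjective _ (tensorHomology_zero_surjective X hse)).trans ?_
    rw [Functor.length_obj_pi, hX]
    simp [(betti_of_shortExact ι ε w hse hι).1, mul_comm]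
  | succ i ih =>
    obtain ⟨N, hfin, hN⟩ := exists_isFirstSyzygy M
    obtain ⟨m, ι, ε, w, hse, hι⟩ := hN.exists_shortExact
    have hb := betti_of_shortExact ι ε w hse hι
    refine (length_le_add_of_exact (tensorHomology_exact₃ X hse i)).trans ?_
    rw [Functor.length_obj_pi, hX, Finset.Nat.sum_antidiagonal_succ']
    simp only [hb.1, hb.2]
    push_cast
    rw [mul_comm]
    refine add_le_add le_rfl ((ih N).trans ?_)
    push_cast
    rfl

/-- Under `hinj` the map from `H(N ⊗ X)` to `H(R^m ⊗ X)` is zero for a minimal cover, so the long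
exact sequence breaks into short ones and each inequality of `length_tensorHomology_le` becomes an
equality. -/
theorem length_tensorHomology
    (hinj : ∀ i, Function.Injective ((tensorHomology X i).map (ModuleCat.residue R)).hom)
    (i : ℕ) (M : ModuleCat.{u} R) [Module.Finite R M] :
    Module.length R ((tensorHomology X i).obj M) =
      (∑ p ∈ Finset.HasAntidiagonal.antidiagonal i, h p.1 * betti R M p.2 : ℕ) := by
  induction i generalizing M with
  | zero =>
    obtain ⟨N, hfin, hN⟩ := exists_isFirstSyzygy M
    obtain ⟨m, ι, ε, w, hse, hι⟩ := hN.exists_shortExact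
    have h0 := (tensorHomology X 0).map_eq_zero_of_mem_maximalIdeal (hinj 0) ι hι
    have h2 := tensorHomology_exact₂ X hse 0
    dsimp only at h2
    rw [h0] at h2
    refine le_antisymm (length_tensorHomology_le X hX 0 M) ?_
    have hle := Module.length_le_of_injective ((tensorHomology X 0).map ε).hom
      ((injective_iff_map_eq_zero _).2 fun x hx => by
        obtain ⟨y, rfl⟩ := (h2 x).1 hx
        rfl)
    rw [Functor.length_obj_pi, hX] at hle
    simpa [(betti_of_shortExact ι ε w hse hι).1, mul_comm] using hle
  | succ i ih =>
    obtain ⟨N, hfin, hN⟩ := exists_isFirstSyzygy M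
    obtain ⟨m, ι, ε, w, hse, hι⟩ := hN.exists_shortExact
    have hb := betti_of_shortExact ι ε w hse hι
    have h0 (j : ℕ) := (tensorHomology X j).map_eq_zero_of_mem_maximalIdeal (hinj j) ι hι
    have h2 := tensorHomology_exact₂ X hse (i + 1)
    have h1 := tensorHomology_exact₁ X hse i
    dsimp only at h1 h2
    rw [h0] at h1 h2
    refine (Module.length_eq_add_of_exact _ _ ?_ ?_ (tensorHomology_exact₃ X hse i)).trans ?_
    · exact (injective_iff_map_eq_zero _).2 fun x hx => by
        obtain ⟨y, rfl⟩ := (h2 x).1 hx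
        rfl
    · exact fun x => (h1 x).1 rfl
    · refine (congrArg₂ (· + ·) ((tensorHomology X (i + 1)).length_obj_pi m) (ih N)).trans ?_
      rw [hX, Finset.Nat.sum_antidiagonal_succ']
      simp only [hb.1, hb.2]
      push_cast
      rw [mul_comm]

omit hX [IsNoetherianRing R] in
theorem shortExact_residue :
    (ShortComplex.mk (ModuleCat.ofHom (maximalIdeal R).subtype) (ModuleCat.residue R) (by
      ext x; exact (residue_eq_zero_iff _).2 x.2)).ShortExact := by
  refine ShortComplex.ShortExact.mk' ?_ ?_ ?_
  · rw [ShortComplex.ShortExact.moduleCat_exact_iff_function_exact]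
    intro x
    exact (residue_eq_zero_iff x).trans ⟨fun hx => ⟨⟨x, hx⟩, rfl⟩, by rintro ⟨y, rfl⟩; exact y.2⟩
  · rw [ModuleCat.mono_iff_injective]
    exact Subtype.val_injective
  · rw [ModuleCat.epi_iff_surjective]
    exact residue_surjective

omit hX in
theorem betti_of_cyclic {M : Type u} [AddCommGroup M] [Module R M] [Nontrivial M]
    (f : R →ₗ[R] M) (hf : Function.Surjective f) :
    betti R M 0 = 1 ∧ ∀ n, betti R M (n + 1) = betti R (LinearMap.ker f) n := by
  let e := LinearEquiv.funUnique (Fin 1) R R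
  let ι : ModuleCat.of R (LinearMap.ker f) ⟶ ModuleCat.of R (Fin 1 → R) :=
    ModuleCat.ofHom (e.symm.toLinearMap ∘ₗ (LinearMap.ker f).subtype)
  let ε : ModuleCat.of R (Fin 1 → R) ⟶ ModuleCat.of R M := ModuleCat.ofHom (f ∘ₗ e.toLinearMap)
  have w : ι ≫ ε = 0 := by
    refine ModuleCat.hom_ext (LinearMap.ext fun x => ?_)
    change f (e (e.symm x)) = 0
    rw [e.apply_symm_apply]
    exact x.2
  refine betti_of_shortExact ι ε w (ShortComplex.ShortExact.mk' ?_ ?_ ?_) fun x => ?_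
  · rw [ShortComplex.ShortExact.moduleCat_exact_iff_function_exact]
    refine fun y => ⟨fun hy => ⟨⟨e y, hy⟩, e.symm_apply_apply y⟩, ?_⟩
    rintro ⟨x, rfl⟩
    exact congrArg (fun g => g.hom x) w
  · rw [ModuleCat.mono_iff_injective]
    exact e.symm.injective.comp Subtype.val_injective
  · rw [ModuleCat.epi_iff_surjective]
    exact hf.comp e.surjective
  -- A unit in the kernel would kill the generator `f 1`, and `M` is nonzero; hence the cover is
  -- minimal.
  · have hx : (x : R) ∈ maximalIdeal R := by
      rw [mem_maximalIdeal, mem_nonunits_iff]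
      intro hu
      have h0 : f 1 = 0 := by
        obtain ⟨v, hv⟩ := hu
        have : f (v : R) = 0 := by rw [hv]; exact x.2
        rw [← mul_one (v : R), ← smul_eq_mul, map_smul] at this
        simpa using congrArg (fun y => (↑v⁻¹ : R) • y) this
      obtain ⟨y, hy⟩ := exists_ne (0 : M)
      obtain ⟨r, rfl⟩ := hf y
      rw [← mul_one r, ← smul_eq_mul, map_smul, h0, smul_zero] at hy
      exact hy rfl
    have : ι.hom x = (x : R) • e.symm 1 := by
      rw [← map_smul, smul_eq_mul, mul_one]; rfl
    rw [this]
    exact Submodule.smul_mem_smul hx trivial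

omit hX in
theorem betti_residueField :
    betti R (ResidueField R) 0 = 1 ∧
      ∀ n, betti R (ResidueField R) (n + 1) = betti R (maximalIdeal R) n := by
  have h := betti_of_cyclic (Algebra.linearMap R (ResidueField R)) residue_surjective
  refine ⟨h.1, fun n => (h.2 n).trans (betti_congr (LinearEquiv.ofEq _ _ ?_) n)⟩
  ext x
  exact residue_eq_zero_iff x

/-- If the bound on `Hᵢ(k ⊗ X)` is attained, then `Hᵢ(X) → Hᵢ(k ⊗ X)` is injective. -/
theorem injective_tensorHomology_residue
    (heq : ∀ i, Module.length R ((tensorHomology X i).obj (ModuleCat.of R (ResidueField R))) =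
      (∑ p ∈ Finset.HasAntidiagonal.antidiagonal i, h p.1 * betti R (ResidueField R) p.2 : ℕ))
    (i : ℕ) :
    Function.Injective ((tensorHomology X i).map (ModuleCat.residue R)).hom := by
  have hres := shortExact_residue (R := R)
  obtain ⟨hb0, hb⟩ := betti_residueField (R := R)
  set p := ((tensorHomology X i).map (ModuleCat.residue R)).hom with hp
  -- In positive degree, `H_i(k ⊗ X)` is exhausted by the range of `p` and the image of the
  -- connecting map into `H_{i-1}(𝔪 ⊗ X)`. The bound for `𝔪` accounts for every term of the sum
  -- except `h i`, which must therefore come from `p`.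
  have hrange : (h i : ℕ∞) ≤ Module.length R (LinearMap.range p) := by
    cases i with
    | zero =>
      have h1 := heq 0
      rw [Finset.Nat.antidiagonal_zero, Finset.sum_singleton, hb0, mul_one] at h1
      rw [LinearMap.range_eq_top.2 (tensorHomology_zero_surjective X hres), Module.length_top]
      exact h1.ge
    | succ i =>
      have h1 := length_eq_range_add_range (tensorHomology_exact₃ X hres i)
      have h2 := heq (i + 1)
      rw [Finset.Nat.sum_antidiagonal_succ', hb0, mul_one] at h2
      simp only [hb] at h2
      have h3 := (Module.length_le_of_injective (LinearMap.range
        ((hres.map_tensorComplex X).δ (i + 1) i rfl).hom).subtype Subtype.val_injective).trans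
        (length_tensorHomology_le X hX i (ModuleCat.of R (maximalIdeal R)))
      have h4 := h1.symm.trans h2
      rw [Nat.cast_add] at h4
      refine (ENat.add_le_add_iff_right (ENat.natCast_ne_top _)).1 (h4.ge.trans ?_)
      exact add_le_add le_rfl h3
  have hadd := length_eq_range_add_range (LinearMap.exact_subtype_ker_map p)
  rw [hX, Submodule.range_subtype] at hadd
  have : Module.length R (LinearMap.ker p) = 0 := by
    have h1 : Module.length R (LinearMap.ker p) + h i ≤ 0 + h i := by
      rw [zero_add]
      exact (add_le_add le_rfl hrange).trans hadd.ge
    exact le_antisymm ((ENat.add_le_add_iff_right (ENat.natCast_ne_top _)).1 h1) zero_le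
  rw [Module.length_eq_zero_iff, Submodule.subsingleton_iff_eq_bot] at this
  exact LinearMap.ker_eq_bot.1 this

end Golod

/-! ### Functorial resolutions of the residue field and balance of `Tor`. -/

namespace Golod

open MonoidalCategory

section FreeSyzygy

variable (S : Type u) [CommRing S]

/-- The syzygies of a module in its functorial resolution by the free modules on all elements. -/
noncomputable def freeSyzygy (M : ModuleCat.{u} S) : ℕ → ModuleCat.{u} S
  | 0 => M
  | n + 1 => ModuleCat.of S (LinearMap.ker
      (Finsupp.linearCombination S (id : freeSyzygy M n → freeSyzygy M n)))

/-- The functorial free resolution of a module. -/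
noncomputable def freeSyzygySequence (M : ModuleCat.{u} S) : SyzygySequence S where
  M := freeSyzygy S M
  P n := ModuleCat.of S (freeSyzygy S M n →₀ S)
  ι n := ModuleCat.ofHom (LinearMap.ker
      (Finsupp.linearCombination S (id : freeSyzygy S M n → freeSyzygy S M n))).subtype
  ε n := ModuleCat.ofHom
    (Finsupp.linearCombination S (id : freeSyzygy S M n → freeSyzygy S M n))
  w n := by
    ext x
    exact x.2
  shortExact n := by
    refine ShortComplex.ShortExact.mk' ?_ ?_ ?_
    · rw [ShortComplex.ShortExact.moduleCat_exact_iff_function_exact]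
      exact fun x => ⟨fun hx => ⟨⟨x, hx⟩, rfl⟩, by rintro ⟨y, rfl⟩; exact y.2⟩
    · rw [ModuleCat.mono_iff_injective]
      exact Subtype.val_injective
    · rw [ModuleCat.epi_iff_surjective]
      exact Finsupp.linearCombination_id_surjective S _

instance (M : ModuleCat.{u} S) (n : ℕ) : Projective ((freeSyzygySequence S M).P n) :=
  ModuleCat.projective_of_free (Finsupp.basisSingleOne (R := S) (ι := freeSyzygy S M n))

/-- The functorial free resolution of the residue field. -/
noncomputable def residueResolution [IsLocalRing S] :
    ProjectiveResolution (ModuleCat.of S (ResidueField S)) :=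
  (freeSyzygySequence S (ModuleCat.of S (ResidueField S))).resolution

end FreeSyzygy

section Unit

variable {R : Type u} [CommRing R]

/-- Tensoring a complex with the ring does not change it. -/
noncomputable def tensorComplexUnit (X : ChainComplex (ModuleCat.{u} R) ℕ) :
    (tensorComplex X).obj (ModuleCat.of R R) ≅ X :=
  HomologicalComplex.Hom.isoOfComponents (fun i => λ_ (X.X i))
    fun i j _ => (leftUnitor_naturality (X.d i j)).symm

theorem tensorComplexMap_app_unit {X Y : ChainComplex (ModuleCat.{u} R) ℕ} (φ : X ⟶ Y) :
    (tensorComplexMap φ).app (ModuleCat.of R R) ≫ (tensorComplexUnit Y).hom =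
      (tensorComplexUnit X).hom ≫ φ := by
  ext i : 1
  exact leftUnitor_naturality (φ.f i)

instance {X Y : ChainComplex (ModuleCat.{u} R) ℕ} (φ : X ⟶ Y) [QuasiIso φ] (i : ℕ) :
    IsIso ((tensorHomologyMap φ i).app (ModuleCat.of R R)) := by
  have h := congrArg (fun f => HomologicalComplex.homologyMap f i) (tensorComplexMap_app_unit φ)
  simp only [HomologicalComplex.homologyMap_comp] at h
  have (Z : ChainComplex (ModuleCat.{u} R) ℕ) :
      IsIso (HomologicalComplex.homologyMap (tensorComplexUnit Z).hom i) :=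
    inferInstanceAs (IsIso ((HomologicalComplex.homologyFunctor _ _ i).map _))
  have h' : IsIso (HomologicalComplex.homologyMap ((tensorComplexMap φ).app (ModuleCat.of R R)) i ≫
      HomologicalComplex.homologyMap (tensorComplexUnit Y).hom i) := by
    rw [h]; infer_instance
  exact (isIso_comp_right_iff _ (HomologicalComplex.homologyMap (tensorComplexUnit Y).hom i)).1 h'

theorem length_tensorHomology_unit (X : ChainComplex (ModuleCat.{u} R) ℕ) (i : ℕ) :
    Module.length R ((tensorHomology X i).obj (ModuleCat.of R R)) =
      Module.length R (X.homology i) :=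
  ((HomologicalComplex.homologyFunctor _ _ i).mapIso (tensorComplexUnit X)).toLinearEquiv.length_eq

end Unit

variable {S : Type u} [CommRing S] [IsLocalRing S]

/-- Followed by the multiplication `k ⊗ k → k`, this map is the unit isomorphism, so it is
injective. -/
theorem isIso_residue_whiskerRight :
    IsIso (ModuleCat.residue S ▷ ModuleCat.of S (ResidueField S)) := by
  rw [ConcreteCategory.isIso_iff_bijective]
  constructor
  · have h : LinearMap.mul' S (ResidueField S) ∘ₗ
        LinearMap.rTensor (ResidueField S) (Algebra.linearMap S (ResidueField S)) =
          (TensorProduct.lid S (ResidueField S)).toLinearMap := by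
      ext
      simp
    have h' : Function.Injective (LinearMap.mul' S (ResidueField S) ∘ₗ
        LinearMap.rTensor (ResidueField S) (Algebra.linearMap S (ResidueField S))) := by
      rw [h]; exact (TensorProduct.lid S (ResidueField S)).injective
    exact Function.Injective.of_comp h'
  · exact LinearMap.rTensor_surjective _ (g := Algebra.linearMap S (ResidueField S))
      residue_surjective

instance (P : ProjectiveResolution (ModuleCat.of S (ResidueField S))) (i : ℕ) :
    Module.Flat S (P.complex.X i) := by
  have := P.projective i
  have : Module.Projective S (P.complex.X i) := inferInstance
  infer_instance

theorem length_homology_resolution (P : ProjectiveResolution (ModuleCat.of S (ResidueField S)))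
    (i : ℕ) : Module.length S ((tensorHomology P.complex i).obj (ModuleCat.of S S)) =
      (if i = 0 then 1 else 0 : ℕ) := by
  rw [length_tensorHomology_unit]
  cases i with
  | zero =>
    rw [(asIso (HomologicalComplex.homologyMap P.π 0) ≪≫
      HomologicalComplex.singleObjHomologySelfIso _ _ _).toLinearEquiv.length_eq]
    rw [Module.length_eq_of_surjective (R := ResidueField S) residue_surjective,
      Module.length_eq_one]
    rfl
  | succ i =>
    have := ModuleCat.subsingleton_of_isZero (P.complex_exactAt_succ i).isZero_homology
    rw [Module.length_eq_zero]
    rfl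

/-- A resolution of `k` has homology only in degree `0`, where the map is compared with the
isomorphism `S ⊗ k → k ⊗ k`. This makes `length_tensorHomology` applicable to the resolution itself.
-/
theorem injective_tensorHomology_resolution
    (P : ProjectiveResolution (ModuleCat.of S (ResidueField S))) (i : ℕ) :
    Function.Injective ((tensorHomology P.complex i).map (ModuleCat.residue S)).hom := by
  cases i with
  | zero =>
    let Y := (ChainComplex.single₀ (ModuleCat.{u} S)).obj (ModuleCat.of S (ResidueField S))
    have : IsIso ((tensorComplex Y).map (ModuleCat.residue S)) := by
      have (i : ℕ) : IsIso (((tensorComplex Y).map (ModuleCat.residue S)).f i) := by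
        cases i with
        | zero => exact isIso_residue_whiskerRight
        | succ i =>
          have h0 := HomologicalComplex.isZero_single_obj_X (V := ModuleCat.{u} S)
            (ComplexShape.down ℕ) 0 (ModuleCat.of S (ResidueField S)) (i + 1) (by simp)
          exact ((tensorLeft (ModuleCat.of S S)).map_isZero h0).isIso
            ((tensorLeft (ModuleCat.of S (ResidueField S))).map_isZero h0) _
      exact HomologicalComplex.Hom.isIso_of_components _
    have h := (tensorHomologyMap P.π 0).naturality (ModuleCat.residue S)
    have h1 : IsIso ((tensorHomologyMap P.π 0).app (ModuleCat.of S S)) := inferInstance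
    have h2 : IsIso ((tensorHomology Y 0).map (ModuleCat.residue S)) :=
      inferInstanceAs (IsIso ((HomologicalComplex.homologyFunctor _ _ 0).map _))
    -- Only the augmentation tensored with `S` has to be an isomorphism: the first factor of a
    -- monomorphism is a monomorphism.
    have h3 : Mono ((tensorHomology P.complex 0).map (ModuleCat.residue S) ≫
        (tensorHomologyMap P.π 0).app (ModuleCat.of S (ResidueField S))) := by
      rw [h]
      exact mono_comp' (IsIso.mono_of_iso _) (IsIso.mono_of_iso _)
    exact (ModuleCat.mono_iff_injective _).1
      (mono_of_mono _ ((tensorHomologyMap P.π 0).app (ModuleCat.of S (ResidueField S))))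
  | succ i =>
    have h := length_homology_resolution P (i + 1)
    rw [if_neg i.succ_ne_zero, Nat.cast_zero, Module.length_eq_zero_iff] at h
    exact Function.injective_of_subsingleton _

/-- Balance of `Tor` for Betti numbers. -/
theorem length_tensorHomology_resolution [IsNoetherianRing S]
    (P : ProjectiveResolution (ModuleCat.of S (ResidueField S))) (i : ℕ) (M : ModuleCat.{u} S)
    [Module.Finite S M] :
    Module.length S ((tensorHomology P.complex i).obj M) = betti S M i := by
  -- Here `h = (1, 0, 0, …)`, so the convolution collapses to a single Betti number.
  rw [length_tensorHomology P.complex (length_homology_resolution P)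
    (injective_tensorHomology_resolution P), Finset.Nat.sum_antidiagonal_eq_sum_range_succ_mk,
    Finset.sum_eq_single 0]
  · simp
  · intro j _ hj
    simp [hj]
  · simp

end Golod

/-! ### Comparison of functorial resolutions over `Q` and `R`, and base change. -/

namespace Golod

section FreeMap

variable {Q R : Type*} [CommRing Q] [CommRing R] [Algebra Q R]
  {M N : Type*} [AddCommGroup M] [Module Q M] [AddCommGroup N] [Module R N]
  (σ : M →ₛₗ[algebraMap Q R] N)

/-- The map between the free modules on all elements induced by a semilinear map. -/
noncomputable def freeMap : (M →₀ Q) →ₗ[Q] (N →₀ R) :=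
  Finsupp.linearCombination Q fun x => Finsupp.single (σ x) (1 : R)

theorem freeMap_single (x : M) (q : Q) :
    freeMap σ (Finsupp.single x q) = Finsupp.single (σ x) (algebraMap Q R q) := by
  rw [freeMap, Finsupp.linearCombination_single, Finsupp.smul_single, Algebra.smul_def, mul_one]

theorem linearCombination_freeMap (x : M →₀ Q) :
    Finsupp.linearCombination R id (freeMap σ x) = σ (Finsupp.linearCombination Q id x) := by
  induction x using Finsupp.induction_linear with
  | zero => simp
  | add x y hx hy => simp only [map_add, hx, hy]
  | single x q => simp [freeMap_single]

variable {σ}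

theorem freeMap_surjective (hQ : Function.Surjective (algebraMap Q R))
    (hσ : Function.Surjective σ) : Function.Surjective (freeMap σ) := by
  intro y
  induction y using Finsupp.induction_linear with
  | zero => exact ⟨0, map_zero _⟩
  | add x y hx hy =>
    obtain ⟨a, rfl⟩ := hx
    obtain ⟨b, rfl⟩ := hy
    exact ⟨a + b, map_add _ _ _⟩
  | single y r =>
    obtain ⟨x, rfl⟩ := hσ y
    obtain ⟨q, rfl⟩ := hQ r
    exact ⟨_, freeMap_single σ x q⟩

variable (σ) in
/-- The map between the first syzygies in the functorial resolutions. -/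
noncomputable def kerFreeMap :
    LinearMap.ker (Finsupp.linearCombination Q (id : M → M)) →ₛₗ[algebraMap Q R]
      LinearMap.ker (Finsupp.linearCombination R (id : N → N)) where
  toFun x := ⟨freeMap σ x, by
    rw [LinearMap.mem_ker, linearCombination_freeMap, x.2, map_zero]⟩
  map_add' x y := Subtype.ext (map_add (freeMap σ) _ _)
  map_smul' q x := Subtype.ext
    ((map_smul (freeMap σ) q x.1).trans (algebraMap_smul R q (freeMap σ x.1)).symm)

theorem kerFreeMap_surjective (hQ : Function.Surjective (algebraMap Q R))
    (hσ : Function.Surjective σ) : Function.Surjective (kerFreeMap σ) := by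
  rintro ⟨y, hy⟩
  obtain ⟨x, rfl⟩ := freeMap_surjective hQ hσ y
  rw [LinearMap.mem_ker, linearCombination_freeMap] at hy
  -- The lift `x` need not be a syzygy. Subtracting the generator of its value `v` repairs this;
  -- since `σ v = 0`, that generator maps to the generator of `0`, and adding the generator of `0`
  -- restores the image without changing the value.
  refine ⟨⟨x - Finsupp.single (Finsupp.linearCombination Q id x) 1 + Finsupp.single 0 1, ?_⟩,
    Subtype.ext ?_⟩
  · simp
  · simp [kerFreeMap, freeMap_single, hy]

end FreeMap

variable {Q R : Type u} [CommRing Q] [CommRing R] [Algebra Q R]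

/-- The comparison of the syzygies in the functorial resolutions over two rings. -/
noncomputable def freeSyzygyMap {M : ModuleCat.{u} Q} {N : ModuleCat.{u} R}
    (σ : M →ₛₗ[algebraMap Q R] N) :
    ∀ n, freeSyzygy Q M n →ₛₗ[algebraMap Q R] freeSyzygy R N n
  | 0 => σ
  | n + 1 => kerFreeMap (freeSyzygyMap σ n)

/-- This is the reason for taking all elements as generators: the comparison of resolutions becomes
onto in every degree, and its kernel can replace a mapping cone. -/
theorem freeSyzygyMap_surjective (hQ : Function.Surjective (algebraMap Q R))
    {M : ModuleCat.{u} Q} {N : ModuleCat.{u} R} {σ : M →ₛₗ[algebraMap Q R] N}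
    (hσ : Function.Surjective σ) (n : ℕ) : Function.Surjective (freeSyzygyMap σ n) := by
  induction n with
  | zero => exact hσ
  | succ n ih => exact kerFreeMap_surjective hQ ih

variable (R) in
/-- Base change of a complex. -/
noncomputable def baseChangeComplex (G : ChainComplex (ModuleCat.{u} Q) ℕ) :
    ChainComplex (ModuleCat.{u} R) ℕ where
  X i := ModuleCat.of R (R ⊗[Q] G.X i)
  d i j := ModuleCat.ofHom ((G.d i j).hom.baseChange R)
  shape i j h := by
    rw [G.shape i j h, ModuleCat.hom_zero, LinearMap.baseChange_zero]; rfl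
  d_comp_d' i j k _ _ := by
    rw [← ModuleCat.ofHom_comp, ← LinearMap.baseChange_comp, ← ModuleCat.hom_comp, G.d_comp_d,
      ModuleCat.hom_zero, LinearMap.baseChange_zero]
    rfl

/-- The differential of the functorial resolution. -/
noncomputable def freeDifferential (S : Type u) [CommRing S] (M : ModuleCat.{u} S) (j : ℕ) :
    (freeSyzygy S M (j + 1) →₀ S) →ₗ[S] (freeSyzygy S M j →₀ S) :=
  (LinearMap.ker (Finsupp.linearCombination S
    (id : freeSyzygy S M j → freeSyzygy S M j))).subtype ∘ₗ
      Finsupp.linearCombination S (id : freeSyzygy S M (j + 1) → freeSyzygy S M (j + 1))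

theorem liftBaseChange_freeMap_comm {M : ModuleCat.{u} Q} {N : ModuleCat.{u} R}
    (σ : M →ₛₗ[algebraMap Q R] N) (j : ℕ) (z : R ⊗[Q] (freeSyzygy Q M (j + 1) →₀ Q)) :
    freeDifferential R N j ((freeMap (freeSyzygyMap σ (j + 1))).liftBaseChange R z) =
    (freeMap (freeSyzygyMap σ j)).liftBaseChange R ((freeDifferential Q M j).baseChange R z) := by
  induction z using TensorProduct.induction_on with
  | zero => simp only [map_zero]
  | add x y hx hy => simp only [map_add, hx, hy]
  | tmul r x =>
    rw [LinearMap.liftBaseChange_tmul, map_smul, LinearMap.baseChange_tmul,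
      LinearMap.liftBaseChange_tmul]
    exact congrArg (fun y => r • (LinearMap.ker
      (Finsupp.linearCombination R (id : freeSyzygy R N j → freeSyzygy R N j))).subtype y)
      (linearCombination_freeMap (freeSyzygyMap σ (j + 1)) x)

/-- The comparison of the functorial resolutions over two rings. -/
noncomputable def comparison {M : ModuleCat.{u} Q} {N : ModuleCat.{u} R}
    (σ : M →ₛₗ[algebraMap Q R] N) :
    baseChangeComplex R (freeSyzygySequence Q M).complex ⟶ (freeSyzygySequence R N).complex where
  f i := ModuleCat.ofHom
    (X := R ⊗[Q] (freeSyzygy Q M i →₀ Q)) (Y := freeSyzygy R N i →₀ R)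
    ((freeMap (freeSyzygyMap σ i)).liftBaseChange R)
  comm' i j h := by
    obtain rfl : j + 1 = i := h
    refine ModuleCat.hom_ext (LinearMap.ext fun z => ?_)
    have hF := congrArg ModuleCat.Hom.hom ((freeSyzygySequence R N).complex_d j)
    have hG := congrArg (fun f => f.hom.baseChange R) ((freeSyzygySequence Q M).complex_d j)
    refine (LinearMap.congr_fun hF _).trans ((liftBaseChange_freeMap_comm σ j z).trans ?_)
    exact congrArg ((freeMap (freeSyzygyMap σ j)).liftBaseChange R) (LinearMap.congr_fun hG z).symm

theorem comparison_f_surjective (hQ : Function.Surjective (algebraMap Q R))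
    {M : ModuleCat.{u} Q} {N : ModuleCat.{u} R} {σ : M →ₛₗ[algebraMap Q R] N}
    (hσ : Function.Surjective σ) (i : ℕ) : Function.Surjective ((comparison σ).f i).hom := by
  intro y
  obtain ⟨x, rfl⟩ := freeMap_surjective hQ (freeSyzygyMap_surjective hQ hσ i) y
  exact ⟨(1 : R) ⊗ₜ[Q] x, LinearMap.liftBaseChange_one_tmul (A := R)
    (freeMap (freeSyzygyMap σ i)) x⟩

theorem length_restrictScalars (hQ : Function.Surjective (algebraMap Q R))
    (H : ModuleCat.{u} R) :
    Module.length Q ((ModuleCat.restrictScalars (algebraMap Q R)).obj H) = Module.length R H := by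
  let := Module.compHom H (algebraMap Q R)
  have : IsScalarTower Q R H := ⟨fun q r x => by rw [Algebra.smul_def, mul_smul]; rfl⟩
  have h := Module.length_eq_of_surjective (R := R) (S := Q) (M := H) hQ
  exact h

section Length

variable (G : ChainComplex (ModuleCat.{u} Q) ℕ)

open MonoidalCategory

instance [∀ i, Module.Flat Q (G.X i)] (i : ℕ) : Module.Flat R ((baseChangeComplex R G).X i) :=
  inferInstanceAs (Module.Flat R (R ⊗[Q] G.X i))

variable (N : Type u) [AddCommGroup N] [Module R N] [Module Q N] [IsScalarTower Q R N]

/-- `N ⊗_R (R ⊗_Q Y) ≅ N ⊗_Q Y` as modules over `Q`. -/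
noncomputable def restrictScalarsTensorEquiv (Y : ModuleCat.{u} Q) :
    (ModuleCat.restrictScalars (algebraMap Q R)).obj (ModuleCat.of R (N ⊗[R] (R ⊗[Q] Y))) ≃ₗ[Q]
      N ⊗[Q] Y where
  __ := (TensorProduct.AlgebraTensorModule.cancelBaseChange Q R R N Y).toAddEquiv
  map_smul' q x :=
    (map_smul (TensorProduct.AlgebraTensorModule.cancelBaseChange Q R R N Y)
      (algebraMap Q R q) (show N ⊗[R] (R ⊗[Q] Y) from x)).trans (algebraMap_smul R q _)

theorem restrictScalarsTensorEquiv_comm {Y Y' : ModuleCat.{u} Q} (f : Y ⟶ Y')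
    (x : N ⊗[R] (R ⊗[Q] Y)) :
    restrictScalarsTensorEquiv N Y' ((f.hom.baseChange R).lTensor N x) =
      f.hom.lTensor N (restrictScalarsTensorEquiv N Y x) := by
  induction x using TensorProduct.induction_on with
  | zero => rfl
  | add x y hx hy =>
    rw [map_add]
    exact (map_add (restrictScalarsTensorEquiv (R := R) N Y') _ _).trans
      ((congrArg₂ _ hx hy).trans (((congrArg _
        (map_add (restrictScalarsTensorEquiv (R := R) N Y) _ _))).trans (map_add _ _ _)).symm)
  | tmul n z =>
    induction z using TensorProduct.induction_on with
    | zero =>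
      rw [TensorProduct.tmul_zero]; rfl
    | add x y hx hy =>
      rw [TensorProduct.tmul_add, map_add]
      exact (map_add (restrictScalarsTensorEquiv (R := R) N Y') _ _).trans
        ((congrArg₂ _ hx hy).trans (((congrArg _
          (map_add (restrictScalarsTensorEquiv (R := R) N Y) _ _))).trans (map_add _ _ _)).symm)
    | tmul r y => rfl

/-- `N ⊗_R (R ⊗_Q G) ≅ N ⊗_Q G` as complexes over `Q`. -/
noncomputable def restrictScalarsTensorIso :
    ((ModuleCat.restrictScalars (algebraMap Q R)).mapHomologicalComplex _).obj
      ((tensorComplex (baseChangeComplex R G)).obj (ModuleCat.of R N)) ≅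
    (tensorComplex G).obj (ModuleCat.of Q N) :=
  HomologicalComplex.Hom.isoOfComponents
    (fun i => (restrictScalarsTensorEquiv N (G.X i)).toModuleIso) fun i j _ =>
      ModuleCat.hom_ext (LinearMap.ext fun x =>
        (restrictScalarsTensorEquiv_comm N (G.d i j) x).symm)

/-- Restriction of scalars is exact, so it commutes with homology, and along a surjection it
preserves length. -/
theorem length_tensorHomology_baseChange (hQ : Function.Surjective (algebraMap Q R)) (i : ℕ) :
    Module.length R ((tensorHomology (baseChangeComplex R G) i).obj (ModuleCat.of R N)) =
      Module.length Q ((tensorHomology G i).obj (ModuleCat.of Q N)) := by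
  let F := ModuleCat.restrictScalars.{u} (algebraMap Q R)
  let C := (tensorComplex (baseChangeComplex R G)).obj (ModuleCat.of R N)
  have e1 := ((C.sc i).mapHomologyIso F).toLinearEquiv.length_eq
  have e2 := ((HomologicalComplex.homologyFunctor _ _ i).mapIso
    (restrictScalarsTensorIso (R := R) G N)).toLinearEquiv.length_eq
  exact (length_restrictScalars hQ (C.homology i)).symm.trans (e1.symm.trans e2)

end Length

end Golod

/-! ### The long exact sequence of the comparison. -/

namespace Golod

open MonoidalCategory

section Comparison

variable {R : Type u} [CommRing R] {T : ShortComplex (ChainComplex (ModuleCat.{u} R) ℕ)}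
  (hT : T.ShortExact) [∀ i, Projective (T.X₃.X i)]

include hT

/-- The sequence splits in each degree, which makes the kernel a retract of a flat module. -/
theorem flat_X₁ [∀ i, Module.Flat R (T.X₂.X i)] (i : ℕ) : Module.Flat R (T.X₁.X i) := by
  have h := hT.map_of_exact (HomologicalComplex.eval _ _ i)
  have : Projective (T.map (HomologicalComplex.eval _ _ i)).X₃ :=
    inferInstanceAs (Projective (T.X₃.X i))
  have hs := h.splittingOfProjective
  exact Module.Flat.of_retract (T.f.f i).hom hs.r.hom
    (congrArg ModuleCat.Hom.hom hs.f_r)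

section

variable (N : ModuleCat.{u} R) (i : ℕ)

theorem tensorHomologyMap_exact₂ :
    Function.Exact ((tensorHomologyMap T.f i).app N).hom ((tensorHomologyMap T.g i).app N).hom :=
  (ShortComplex.ShortExact.moduleCat_exact_iff_function_exact _).1
    ((hT.map_tensorLeft N).homology_exact₂ i)

theorem tensorHomologyMap_exact₃ :
    Function.Exact ((tensorHomologyMap T.g (i + 1)).app N).hom
      ((hT.map_tensorLeft N).δ (i + 1) i rfl).hom :=
  (ShortComplex.ShortExact.moduleCat_exact_iff_function_exact _).1
    ((hT.map_tensorLeft N).homology_exact₃ (i + 1) i rfl)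

theorem tensorHomologyMap_exact₁ :
    Function.Exact ((hT.map_tensorLeft N).δ (i + 1) i rfl).hom
      ((tensorHomologyMap T.f i).app N).hom :=
  (ShortComplex.ShortExact.moduleCat_exact_iff_function_exact _).1
    ((hT.map_tensorLeft N).homology_exact₁ (i + 1) i rfl)

theorem tensorHomologyMap_zero_surjective :
    Function.Surjective ((tensorHomologyMap T.g 0).app N).hom := by
  have : Epi ((tensorComplexMap T.g).app N) := (hT.map_tensorLeft N).epi_g
  exact homologyMap_zero_surjective ((tensorComplexMap T.g).app N)

end

end Comparison

/-! ### Vanishing descends along syzygies. -/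

section Syzygy

variable {R : Type u} [CommRing R] [IsLocalRing R] {X Y : ChainComplex (ModuleCat.{u} R) ℕ}
  [∀ i, Module.Flat R (X.X i)] [∀ i, Module.Flat R (Y.X i)] (φ : X ⟶ Y)
  (hinj : ∀ i, Function.Injective ((tensorHomology X i).map (ModuleCat.residue R)).hom)

include hinj

/-- By `hinj` and minimality, `H_i(N ⊗ X) → H_i(R^m ⊗ X)` is zero, so the connecting map from
`H_{i+1}(M ⊗ X)` is onto; its naturality in the complex transports the vanishing. -/
theorem tensorHomologyMap_eq_zero_of_isFirstSyzygy {M N : Type u} [AddCommGroup M] [Module R M]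
    [AddCommGroup N] [Module R N] (hN : IsFirstSyzygy R M N) (i : ℕ)
    (h : (tensorHomologyMap φ (i + 1)).app (ModuleCat.of R M) = 0) :
    (tensorHomologyMap φ i).app (ModuleCat.of R N) = 0 := by
  obtain ⟨m, ι, ε, w, hse, hι⟩ := hN.exists_shortExact
  have h0 := (tensorHomology X i).map_eq_zero_of_mem_maximalIdeal (hinj i) ι hι
  have h1 := tensorHomology_exact₁ X hse i
  dsimp only at h1
  rw [h0] at h1
  have : Epi ((hse.map_tensorComplex X).δ (i + 1) i rfl) :=
    (ModuleCat.epi_iff_surjective _).2 fun x => (h1 x).1 rfl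
  have h2 := tensorHomologyMap_δ X i φ hse
  refine (cancel_epi ((hse.map_tensorComplex X).δ (i + 1) i rfl)).1
    (h2.trans (Eq.trans ?_ Limits.comp_zero.symm))
  exact (congrArg (fun f => f ≫ (hse.map_tensorComplex Y).δ (i + 1) i rfl) h).trans
    Limits.zero_comp

theorem tensorHomologyMap_eq_zero_of_isSyzygy {M : Type u} [AddCommGroup M] [Module R M]
    {n : ℕ} {N : Type u} [AddCommGroup N] [Module R N] (hN : IsSyzygy R M n N) (i : ℕ)
    (h : ∀ j, n + i ≤ j → (tensorHomologyMap φ j).app (ModuleCat.of R M) = 0) :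
    (tensorHomologyMap φ i).app (ModuleCat.of R N) = 0 := by
  induction hN generalizing i with
  | zero N e =>
    have h1 := (tensorHomologyMap φ i).naturality e.toModuleIso.hom
    rw [h i (Nat.zero_add i).le, Limits.zero_comp] at h1
    exact (cancel_epi ((tensorHomology X i).map e.toModuleIso.hom)).1
      (h1.trans Limits.comp_zero.symm)
  | succ n L N hL hN ih =>
    refine tensorHomologyMap_eq_zero_of_isFirstSyzygy φ hinj hN i (ih (i + 1) fun j hj => h j ?_)
    omega

end Syzygy

theorem IsSyzygy.finite {R : Type u} [CommRing R] [IsLocalRing R] [IsNoetherianRing R]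
    {M : Type u} [AddCommGroup M] [Module R M]
    [Module.Finite R M] {n : ℕ} {N : Type u} [AddCommGroup N] [Module R N]
    (hN : IsSyzygy R M n N) : Module.Finite R N := by
  induction hN with
  | zero N e => exact Module.Finite.equiv e
  | succ n L N hL hN ih =>
    obtain ⟨m, f, -, -, ⟨e⟩⟩ := hN
    have : Module.Finite R (LinearMap.ker f) := Module.Finite.of_fg (IsNoetherian.noetherian _)
    exact Module.Finite.equiv e.symm

/-! ### Golod rings and Golod modules through the kernel of the comparison. -/

section Golod

variable {Q R : Type u} [CommRing Q] [IsLocalRing Q] [CommRing R] [IsLocalRing R] [Algebra Q R]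

/-- The positive Betti numbers of `R` over `Q`. -/
noncomputable def relativeBetti (Q R : Type u) [CommRing Q] [IsLocalRing Q] [CommRing R]
    [Algebra Q R] (i : ℕ) : ℕ :=
  if i = 0 then 0 else betti Q R i

theorem betti_algebra_zero [IsNoetherianRing Q] (hQ : Function.Surjective (algebraMap Q R)) :
    betti Q R 0 = 1 :=
  (betti_of_cyclic (Algebra.linearMap Q R) hQ).1

/-- The Golod condition in terms of Betti numbers. -/
theorem poincareSeries_eq_golodBound_iff [IsNoetherianRing Q]
    (hQ : Function.Surjective (algebraMap Q R)) (N : Type u)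
    [AddCommGroup N] [Module R N] [Module Q N] :
    poincareSeries R N = golodBound Q R N ↔ betti R N 0 = betti Q N 0 ∧
      ∀ i, betti R N (i + 1) = betti Q N (i + 1) +
        ∑ p ∈ Finset.HasAntidiagonal.antidiagonal i, relativeBetti Q R p.1 * betti R N p.2 := by
  have hH : poincareSeries Q R - 1 = PowerSeries.mk fun i => (relativeBetti Q R i : ℤ) := by
    ext i
    cases i with
    | zero => simp [poincareSeries, relativeBetti, betti_algebra_zero hQ]
    | succ i => simp [poincareSeries, relativeBetti, PowerSeries.coeff_one]
  -- With the denominator cleared, the Golod equation is a recursion for the Betti numbers; the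
  -- factor `X` shifts the convolution by one degree.
  have h1 : poincareSeries R N = golodBound Q R N ↔
      poincareSeries R N = poincareSeries Q N +
        PowerSeries.X * ((poincareSeries Q R - 1) * poincareSeries R N) := by
    have hinv := golodDenominator_mul_invOfUnit Q R
    constructor
    · intro h
      have h2 : poincareSeries R N * golodDenominator Q R = poincareSeries Q N := by
        rw [h, golodBound, mul_assoc, mul_comm (PowerSeries.invOfUnit _ _), hinv, mul_one]
      rw [← h2, golodDenominator]
      ring
    · intro h
      have h2 : poincareSeries R N * golodDenominator Q R = poincareSeries Q N := by
        rw [golodDenominator]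
        linear_combination h
      rw [golodBound, ← h2, mul_assoc, hinv, mul_one]
  rw [h1, hH, PowerSeries.ext_iff]
  constructor
  · refine fun h => ⟨?_, fun i => ?_⟩
    · simpa [poincareSeries] using h 0
    · have := h (i + 1)
      rw [map_add, PowerSeries.coeff_succ_X_mul, PowerSeries.coeff_mul] at this
      simp only [poincareSeries, PowerSeries.coeff_mk] at this
      exact_mod_cast this
  · rintro ⟨h0, h⟩ (_ | i)
    · simpa [poincareSeries] using h0
    · rw [map_add, PowerSeries.coeff_succ_X_mul, PowerSeries.coeff_mul]
      simp only [poincareSeries, PowerSeries.coeff_mk]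
      exact_mod_cast h i

/-- The map of residue fields. -/
noncomputable def residueMap (hQ : Function.Surjective (algebraMap Q R)) :
    ResidueField Q →ₛₗ[algebraMap Q R] ResidueField R :=
  haveI := hQ.isLocalHom
  { ResidueField.map (algebraMap Q R) with
    map_smul' := fun q x => by
      change ResidueField.map (algebraMap Q R) (q • x) = _
      rw [Algebra.smul_def, map_mul, Algebra.smul_def]
      rfl }

theorem residueMap_surjective (hQ : Function.Surjective (algebraMap Q R)) :
    Function.Surjective (residueMap hQ) := by
  have := hQ.isLocalHom
  intro y
  obtain ⟨r, rfl⟩ := residue_surjective y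
  obtain ⟨q, rfl⟩ := hQ r
  exact ⟨residue Q q, ResidueField.map_residue _ q⟩

/-- The comparison of the functorial resolutions of the residue fields, as a short exact
sequence of complexes. -/
noncomputable def comparisonSequence (hQ : Function.Surjective (algebraMap Q R)) :
    ShortComplex (ChainComplex (ModuleCat.{u} R) ℕ) where
  X₁ := _
  X₂ := baseChangeComplex R (residueResolution Q).complex
  X₃ := (residueResolution R).complex
  f := Limits.kernel.ι _
  g := comparison (M := ModuleCat.of Q (ResidueField Q)) (N := ModuleCat.of R (ResidueField R))
    (residueMap hQ)
  zero := Limits.kernel.condition _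

theorem comparisonSequence_shortExact (hQ : Function.Surjective (algebraMap Q R)) :
    (comparisonSequence hQ).ShortExact := by
  have : Epi (comparisonSequence hQ).g := by
    have (i : ℕ) : Epi ((comparisonSequence hQ).g.f i) :=
      (ModuleCat.epi_iff_surjective _).2
        (comparison_f_surjective hQ (residueMap_surjective hQ) i)
    exact HomologicalComplex.epi_of_epi_f _ this
  have : Mono (comparisonSequence hQ).f :=
    inferInstanceAs (Mono (Limits.kernel.ι (comparisonSequence hQ).g))
  exact { exact := ShortComplex.exact_kernel (comparisonSequence hQ).g }

instance (hQ : Function.Surjective (algebraMap Q R)) (i : ℕ) :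
    Projective ((comparisonSequence hQ).X₃.X i) :=
  (residueResolution R).projective i

instance (hQ : Function.Surjective (algebraMap Q R)) (i : ℕ) :
    Module.Flat R ((comparisonSequence hQ).X₂.X i) :=
  inferInstanceAs (Module.Flat R ((baseChangeComplex R (residueResolution Q).complex).X i))

instance (hQ : Function.Surjective (algebraMap Q R)) (i : ℕ) :
    Module.Flat R ((comparisonSequence hQ).X₁.X i) :=
  flat_X₁ (comparisonSequence_shortExact hQ) i

variable (hQ : Function.Surjective (algebraMap Q R))

theorem betti_self_succ (i : ℕ) : betti R R (i + 1) = 0 :=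
  haveI : Projective (ModuleCat.of R R) :=
    ModuleCat.projective_of_free (Module.Basis.singleton Unit R)
  betti_succ_of_projective (ModuleCat.of R R) i

section

variable (N : Type u) [AddCommGroup N] [Module R N] [Module.Finite R N]

theorem length_tensorHomology_X₃ [IsNoetherianRing R] (i : ℕ) :
    Module.length R ((tensorHomology (comparisonSequence hQ).X₃ i).obj (ModuleCat.of R N)) =
      betti R N i :=
  length_tensorHomology_resolution (residueResolution R) i (ModuleCat.of R N)

theorem length_tensorHomology_X₂ [IsNoetherianRing Q] [Module Q N] [IsScalarTower Q R N] (i : ℕ) :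
    Module.length R ((tensorHomology (comparisonSequence hQ).X₂ i).obj (ModuleCat.of R N)) =
      betti Q N i := by
  have : Module.Finite Q R := Module.Finite.of_surjective (Algebra.linearMap Q R) hQ
  have : Module.Finite Q N := Module.Finite.trans R N
  exact (length_tensorHomology_baseChange (residueResolution Q).complex N hQ i).trans
    (length_tensorHomology_resolution (residueResolution Q) i (ModuleCat.of Q N))

end

theorem subsingleton_tensorHomology_X₃ [IsNoetherianRing R] (i : ℕ) :
    Subsingleton ((tensorHomology (comparisonSequence hQ).X₃ (i + 1)).obj (ModuleCat.of R R)) := by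
  rw [← Module.length_eq_zero_iff (R := R), length_tensorHomology_X₃ hQ R (i + 1),
    betti_self_succ]
  rfl

variable [IsNoetherianRing Q] [IsNoetherianRing R]

theorem betti_self_zero : betti R R 0 = 1 :=
  (betti_of_cyclic LinearMap.id Function.surjective_id).1

/-- With coefficients `R` the higher `Tor^R` vanish, so `H_i(K)` embeds in `Tor^Q_i(R, k)`, and is
all of it for `i > 0`. In degree `0` the quotient `Tor^R_0(R, k)` already has the full length `1`,
which leaves `H_0(K) = 0`. -/
theorem length_tensorHomology_X₁ (i : ℕ) :
    Module.length R ((tensorHomology (comparisonSequence hQ).X₁ i).obj (ModuleCat.of R R)) =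
      relativeBetti Q R i := by
  have hT := comparisonSequence_shortExact hQ
  have := subsingleton_tensorHomology_X₃ hQ
  have h1 := tensorHomologyMap_exact₁ hT (ModuleCat.of R R) i
  have h2 := tensorHomologyMap_exact₂ hT (ModuleCat.of R R) i
  have hinj : Function.Injective
      ((tensorHomologyMap (comparisonSequence hQ).f i).app (ModuleCat.of R R)).hom :=
    (injective_iff_map_eq_zero _).2 fun x hx => by
      obtain ⟨y, rfl⟩ := (h1 x).1 hx
      rw [(this i).elim y 0]
      exact map_zero _
  cases i with
  | zero =>
    have hadd := Module.length_eq_add_of_exact _ _ hinj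
      (tensorHomologyMap_zero_surjective hT (ModuleCat.of R R)) h2
    have hadd' : (betti Q R 0 : ℕ∞) = Module.length R ((tensorHomology
        (comparisonSequence hQ).X₁ 0).obj (ModuleCat.of R R)) + betti R R 0 :=
      (length_tensorHomology_X₂ hQ R 0).symm.trans
        (hadd.trans (congrArg _ (length_tensorHomology_X₃ hQ R 0)))
    rw [betti_algebra_zero hQ, betti_self_zero] at hadd'
    refine le_antisymm ((ENat.add_le_add_iff_right (ENat.natCast_ne_top 1)).1
      (hadd'.ge.trans ?_)) ?_ <;> simp [relativeBetti]
  | succ i =>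
    have hsurj : Function.Surjective
        ((tensorHomologyMap (comparisonSequence hQ).f (i + 1)).app (ModuleCat.of R R)).hom :=
      fun x => (h2 x).1 ((this i).elim _ _)
    exact (le_antisymm (Module.length_le_of_injective _ hinj)
      (Module.length_le_of_surjective _ hsurj)).trans (length_tensorHomology_X₂ hQ R (i + 1))

/-- Over a Golod ring the homology of the complex `comparisonSequence.X₁` injects into its
reduction modulo the maximal ideal. -/
theorem IsGolodRing.injective (hR : IsGolodRing Q R) (i : ℕ) :
    Function.Injective ((tensorHomology (comparisonSequence hQ).X₁ i).map
      (ModuleCat.residue R)).hom := by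
  have hT := comparisonSequence_shortExact hQ
  obtain ⟨-, hG⟩ := ((poincareSeries_eq_golodBound_iff hQ (ResidueField R)).1 hR.2)
  refine injective_tensorHomology_residue _ (length_tensorHomology_X₁ hQ) (fun i => ?_) i
  refine le_antisymm (length_tensorHomology_le _ (length_tensorHomology_X₁ hQ) i
    (ModuleCat.of R (ResidueField R))) ?_
  -- The long exact sequence bounds the Betti number of `k` over `R` from above; equality in the
  -- Golod recursion turns this into the missing lower bound for `H_i(k ⊗ K)`.
  have h3 := length_le_add_of_exact
    (tensorHomologyMap_exact₃ hT (ModuleCat.of R (ResidueField R)) i)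
  have h4 : (betti R (ResidueField R) (i + 1) : ℕ∞) ≤ betti Q (ResidueField R) (i + 1) +
      Module.length R ((tensorHomology (comparisonSequence hQ).X₁ i).obj
        (ModuleCat.of R (ResidueField R))) :=
    (length_tensorHomology_X₃ hQ (ResidueField R) (i + 1)).ge.trans
      (h3.trans (add_le_add (length_tensorHomology_X₂ hQ (ResidueField R) (i + 1)).le le_rfl))
  rw [hG i, Nat.cast_add] at h4
  exact (ENat.add_le_add_iff_left (ENat.natCast_ne_top _)).1 h4

/-- Over a Golod ring, a module is Golod if the comparison of Poincaré series has no kernel. -/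
theorem IsGolodRing.isGolodModule_of_eq_zero (hR : IsGolodRing Q R) (N : Type u) [AddCommGroup N]
    [Module R N] [Module Q N] [IsScalarTower Q R N] [Module.Finite R N]
    (h : ∀ i, (tensorHomologyMap (comparisonSequence hQ).f i).app (ModuleCat.of R N) = 0) :
    IsGolodModule Q R N := by
  have hT := comparisonSequence_shortExact hQ
  refine ⟨‹_›, (poincareSeries_eq_golodBound_iff hQ N).2 ?_⟩
  have hinj (i : ℕ) : Function.Injective
      ((tensorHomologyMap (comparisonSequence hQ).g i).app (ModuleCat.of R N)).hom :=
    (injective_iff_map_eq_zero _).2 fun x hx => by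
      obtain ⟨y, rfl⟩ := (tensorHomologyMap_exact₂ hT (ModuleCat.of R N) i x).1 hx
      rw [h i]
      rfl
  -- The vanishing cuts the long exact sequence into an isomorphism in degree `0` and short exact
  -- sequences `0 → Tor^Q_{i+1} → Tor^R_{i+1} → H_i(N ⊗ K) → 0`, whose lengths give the recursion.
  constructor
  · have h1 := le_antisymm (Module.length_le_of_injective _ (hinj 0))
      (Module.length_le_of_surjective _ (tensorHomologyMap_zero_surjective hT (ModuleCat.of R N)))
    exact Nat.cast_injective (R := ℕ∞) ((length_tensorHomology_X₃ hQ N 0).symm.trans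
      (h1.symm.trans (length_tensorHomology_X₂ hQ N 0)))
  · intro i
    have hsurj : Function.Surjective ((hT.map_tensorLeft (ModuleCat.of R N)).δ (i + 1) i rfl).hom :=
      fun x => (tensorHomologyMap_exact₁ hT (ModuleCat.of R N) i x).1 (by rw [h i]; rfl)
    have h1 := Module.length_eq_add_of_exact _ _ (hinj (i + 1)) hsurj
      (tensorHomologyMap_exact₃ hT (ModuleCat.of R N) i)
    have h2 := length_tensorHomology _ (length_tensorHomology_X₁ hQ) (hR.injective hQ) i
      (ModuleCat.of R N)
    have h3 := (length_tensorHomology_X₃ hQ N (i + 1)).symm.trans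
      (h1.trans (congrArg₂ (· + ·) (length_tensorHomology_X₂ hQ N (i + 1)) h2))
    exact_mod_cast h3

end Golod

end Golod

/-! ### Lescot's theorem. -/

theorem mainTheorem7
    (Q R : Type u) [CommRing Q] [IsRegularLocalRing Q] [CommRing R] [IsLocalRing R] [Algebra Q R]
    (hsurj : Function.Surjective (algebraMap Q R))
    (hker : RingHom.ker (algebraMap Q R) ≤ maximalIdeal Q ^ 2)
    (hR : Golod.IsGolodRing Q R)
    (M : Type u) [AddCommGroup M] [Module R M] [Module Q M] [IsScalarTower Q R M]
    [Module.Finite R M]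
    (c : ℕ) (hc : (projectiveDimension (ModuleCat.of Q M)).unbotD 0 = (c : ℕ∞))
    (N : Type u) [AddCommGroup N] [Module R N] [Module Q N] [IsScalarTower Q R N]
    (hN : Golod.IsSyzygy R M (c + 1) N) :
    Golod.IsGolodModule Q R N := by
  have : IsNoetherianRing R := isNoetherianRing_of_surjective Q R (algebraMap Q R) hsurj
  have : Module.Finite Q R := Module.Finite.of_surjective (Algebra.linearMap Q R) hsurj
  have : Module.Finite Q M := Module.Finite.trans R M
  have : Module.Finite R N := hN.finite
  have hpd : HasProjectiveDimensionLT (ModuleCat.of Q M) (c + 1) := by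
    refine (projectiveDimension_le_iff _ c).1 ?_
    -- The value `⊥` is the zero module, for which the default gives `c = 0`; only the bound by `c`
    -- is needed.
    generalize projectiveDimension (ModuleCat.of Q M) = d at hc
    cases d with
    | bot => exact bot_le
    | coe d => exact (congrArg ((↑) : ℕ∞ → WithBot ℕ∞) hc).le
  refine hR.isGolodModule_of_eq_zero hsurj N fun i => ?_
  -- Here `j ≥ c + 1 + i > c`, so the target `Tor^Q_j(M, k)` is zero; the extra syzygy beyond `c` is
  -- what covers `i = 0`.
  refine Golod.tensorHomologyMap_eq_zero_of_isSyzygy _ (hR.injective hsurj) hN i fun j hj => ?_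
  have h0 := Golod.length_tensorHomology_X₂ hsurj M j
  rw [Golod.betti_eq_zero_of_hasProjectiveDimensionLT c (ModuleCat.of Q M) j (by omega),
    Nat.cast_zero, Module.length_eq_zero_iff] at h0
  exact ModuleCat.hom_ext (LinearMap.ext fun x => h0.elim _ _)
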